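/- **Setting.** Fix integers $M,m,l_F,\eta\ge 1$ and put $n_F=m\,l_F$ (radio frequencies), $l_S=m\,\eta$ (twisted pairs per fronthaul cable), $\mu=l_F/n_F=1/m$. Let $\alpha\in[0,1]$, $\beta>0$, $\gamma\ge 0$, $\rho\in[0,1]$, $q,\epsilon_U^D\in[0,1]$, $P_B,P_U\ge 0$, $P_c>0$, and $\lambda=\sqrt{P_c/(P_B(1+2\alpha^2)+1)}$. In one minislot there are $M$ edge nodes (EN), each with one eMBB and one URLLC user. Let $A_k,E_k\in\{0,1\}$ ($k=1,\dots,M$), with $A_k\sim\mathcal B(q)$ (URLLC transmission in cell $k$) and $E_k\sim\mathcal B(q\,\epsilon_U^D)$ (URLLC decoding error at EN $k$), with an arbitrary joint law. Let $\mathbf X,\mathbf U,\mathbf Z\in\mathbb C^{n_F\times M}$ have i.i.d. circularly symmetric complex Gaussian entries of laws $\mathcal{CN}(0,P_B)$, $\mathcal{CN}(0,P_U)$, $\mathcal{CN}(0,1)$ (eMBB signals, URLLC signals, radio noise), and let $\tilde{\mathbf W}_1,\dots,\tilde{\mathbf W}_M\in\mathbb C^{l_F\times l_S}$ (cable noises)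 have i.i.d. $\mathcal{CN}(0,1)$ entries; $(A,E)$, $\mathbf X$, $\mathbf U$, $\mathbf Z$, $\tilde{\mathbf W}$ are mutually independent. Under NOMA with successive interference cancellation (SIC), where a fraction $\rho$ of the URLLC amplitude remains if decoding succeeds and the eMBB signal is discarded if it fails, the signal of EN $k$ at frequency $f$ is $$Y_k^f=(1-A_kE_k)\,(X_k^f+\alpha X_{k+1}^f+\alpha X_{k-1}^f)+\rho\beta A_k(1-E_k)U_k^f+Z_k^f ,$$ with indices $k\pm1$ modulo $M$. The vector $\mathbf y_k=(Y_k^f)_f$ is reshaped column by column into the $l_F\times m$ matrix $\mathbf Y_k$, and the central unit (BBU) receives from EN $k$ $$\mathbf r_k=\mathrm{vec}\Big(\big(\lambda(\mathbf Y_k\otimes \mathbf 1_\eta^T)\mathbf H_c+\tilde{\mathbf W}_k\big)\mathbf G\Big),\qquad \mathbf H_c=\gamma\mathbf 1_{l_S}\mathbf 1_{l_S}^T+(1-\gamma)\mathbf I_{l_S},\quad \mathbf G=\tfrac1\eta(\mathbf I_m\otimes\mathbf 1_\eta).$$ The eMBB per-user rate, in bits per radio resource, is the normalized conditional mutual information $$R_B=\frac{1}{n_FM}\,I(\mathbf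 X;\mathbf r_1,\dots,\mathbf r_M\mid A,E).$$ **Lemma.** Let $\mathbf H\in\mathbb R^{M\times M}$ be the circulant matrix with first column $[1,\alpha,0,\dots,0,\alpha]^T$ (if the two neighbours of a cell coincide, i.e. for $M\le 2$, gains landing on the same entry add up), $\mathbf A=\mathrm{diag}(A_1,\dots,A_M)$, $\mathbf E=\mathrm{diag}(E_1,\dots,E_M)$, and $$\mathbf H_c^\eta=\gamma\eta\,\mathbf 1_{m}\mathbf 1_{m}^T+(1-\gamma)\mathbf I_{m},\qquad \mathbf R_{z_{eq}}=\mathbf I_M\otimes \mathbf H_c^\eta\mathbf H_c^\eta+\frac1{\lambda^2\eta}\mathbf I_{Mm},$$ $$\mathbf H_{AE}=\big((\mathbf I-\mathbf A\mathbf E)\mathbf H\big)\otimes\mathbf H_c^\eta,\qquad \mathbf R_{AE,z_{eq}}=\mathbf R_{z_{eq}}+\rho^2\beta^2P_U\big((\mathbf A(\mathbf I-\mathbf E))\otimes\mathbf H_c^\eta\mathbf H_c^\eta\big).$$ Then, for all binary values of $\mathbf A,\mathbf E$, the matrix $\mathbf R_{AE,z_{eq}}$ is invertible and the determinant below is positive;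 the expectation below exists, $R_B$ is finite, and $$R_B=\frac{\mu}{M}\,\mathbb E_{\mathbf A,\mathbf E}\Big[\log_2\det\big(\mathbf I+P_B\,\mathbf R_{AE,z_{eq}}^{-1}\mathbf H_{AE}\mathbf H_{AE}^T\big)\Big].$$ -/

import Mathlib

open MeasureTheory ProbabilityTheory
open scoped ENNReal Kronecker

noncomputable section

namespace CRAN

/-! ### Index sets

With `m = 1/μ` sub-bands of `lF` frequencies each and redundancy `η`, the radio band has
`nF = m * lF` frequencies, the cable has `lS = m * η` twisted pairs, and `μ = lF / nF`. -/

/-- Radio frequency channels: `(j, f)` is the `f`-th frequency of the `j`-th sub-vector. -/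
abbrev Freq (m lF : ℕ) : Type := Fin m × Fin lF

/-- Twisted pairs: `(j, i)` is the pair carrying the `i`-th replica of the `j`-th sub-vector. -/
abbrev Pair (m η : ℕ) : Type := Fin m × Fin η

/-- Normalized cable bandwidth `μ = lF / nF`, where `nF = m * lF`. -/
def normBandwidth (m lF : ℕ) : ℝ := (lF : ℝ) / ((m * lF : ℕ) : ℝ)

/-! ### Probability and information theory -/

/-- The circularly symmetric complex Gaussian law `𝒞𝒩(0, v)`, for `v ≥ 0`: real and imaginary
parts are independent real Gaussians of variance `v / 2`. -/
def complexGaussian (v : ℝ) : Measure ℂ :=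
  ((gaussianReal 0 (v / 2).toNNReal).prod (gaussianReal 0 (v / 2).toNNReal)).map
    (fun p : ℝ × ℝ => (⟨p.1, p.2⟩ : ℂ))

/-- The law of an array, indexed by `ι × κ`, of i.i.d. `𝒞𝒩(0, v)` entries. -/
def iidComplexGaussian (ι κ : Type*) [Fintype ι] [Fintype κ] (v : ℝ) : Measure (ι → κ → ℂ) :=
  Measure.pi fun _ => Measure.pi fun _ => complexGaussian v

/-- Mutual information (in nats) of two random variables under the measure `P`: the
Kullback-Leibler divergence of the joint law from the product of the marginal laws. -/
def mutualInfo {Ω α β : Type*} [MeasurableSpace Ω] [MeasurableSpace α] [MeasurableSpace β]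
    (P : Measure Ω) (X : Ω → α) (Y : Ω → β) : ℝ≥0∞ :=
  InformationTheory.klDiv (P.map fun ω => (X ω, Y ω)) ((P.map X).prod (P.map Y))

/-- Conditional mutual information `I(X; Y | S)` (in nats), for `S` with finitely many values:
the average over the values `s` of `S` of the mutual information under `P(· | S = s)`. -/
def condMutualInfo {Ω α β σ : Type*} [MeasurableSpace Ω] [MeasurableSpace α]
    [MeasurableSpace β] [Fintype σ] (P : Measure Ω) (X : Ω → α) (Y : Ω → β) (S : Ω → σ) :
    ℝ≥0∞ :=
  ∑ s, P (S ⁻¹' {s}) * mutualInfo (ProbabilityTheory.cond P (S ⁻¹' {s})) X Y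

/-! ### Radio and fronthaul model -/

/-- `diag(A₁, …, A_M)` for binary `A₁, …, A_M`. -/
def diagBin {M : ℕ} (a : Fin M → Bool) : Matrix (Fin M) (Fin M) ℝ :=
  Matrix.diagonal fun k => if a k then 1 else 0

/-- The circulant Wyner channel matrix: circulant with first column `(1, α, 0, …, 0, α)ᵀ`
(indices mod `M`; if the two neighbours of a cell coincide, their gains add up). -/
def radioChannel (M : ℕ) [NeZero M] (α : ℝ) : Matrix (Fin M) (Fin M) ℝ :=
  Matrix.circulant fun d : Fin M =>
    (if d = 0 then 1 else 0) + (if d = 1 then α else 0) + (if d = -1 then α else 0)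

/-- The signal `Y_k^f` of edge node `k` at frequency `f` after successive interference
cancellation, in a minislot with URLLC activities `a`, URLLC decoding errors `e`, eMBB signals
`x`, URLLC signals `u` and radio noise `z`. Indices `k ± 1` are taken mod `M`. -/
def sicSignal {M : ℕ} [NeZero M] {m lF : ℕ} (α β ρ : ℝ) (a e : Fin M → Bool)
    (x u z : Freq m lF → Fin M → ℂ) (f : Freq m lF) (k : Fin M) : ℂ :=
  (1 - (if a k then 1 else 0) * (if e k then 1 else 0)) *
      (x f k + (α : ℂ) * x f (k + 1) + (α : ℂ) * x f (k - 1))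
    + (ρ : ℂ) * (β : ℂ) * (if a k then 1 else 0) * (1 - (if e k then 1 else 0)) * u f k
    + z f k

/-- Cable power-scaling factor `λ` under NOMA. -/
def cableGain (α PB Pc : ℝ) : ℝ := √(Pc / (PB * (1 + 2 * α ^ 2) + 1))

/-- The fronthaul crosstalk matrix `H_c = γ 1 1ᵀ + (1 - γ) I` over all twisted pairs. -/
def cableChannel (m η : ℕ) (γ : ℝ) : Matrix (Pair m η) (Pair m η) ℝ :=
  γ • Matrix.of (fun _ _ => 1) + (1 - γ) • 1

/-- Mapping of the radio signal of one edge node on the cable: the radio signal, reshaped as the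
`lF × m` matrix of its sub-vectors, with each column repeated on `η` consecutive pairs. -/
def cableMap {m lF : ℕ} (η : ℕ) (y : Freq m lF → ℂ) : Matrix (Fin lF) (Pair m η) ℂ :=
  Matrix.of fun f c => y (c.1, f)

/-- The maximum ratio combiner `G = (1/η) (I_m ⊗ 1_η)`. -/
def combiner (m η : ℕ) : Matrix (Pair m η) (Fin m) ℝ :=
  (η : ℝ)⁻¹ • Matrix.of fun c j => if c.1 = j then 1 else 0

/-- The signal available at the BBU from one edge node with radio signal `y`: scaling by the
gain `lam`, mapping on the cable, cable channel, cable noise `w`, combining, vectorization. -/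
def fronthaul {m lF η : ℕ} (γ lam : ℝ) (y : Freq m lF → ℂ) (w : Fin lF → Pair m η → ℂ) :
    Freq m lF → ℂ := fun jf =>
  ((((lam : ℂ) • cableMap η y) * (cableChannel m η γ).map Complex.ofReal + Matrix.of w) *
    (combiner m η).map Complex.ofReal) jf.2 jf.1

/-- The overall signal at the BBU, from all edge nodes and frequencies, under NOMA with SIC;
`w k` is the cable noise on the link of edge node `k`. -/
def bbuSignal {M : ℕ} [NeZero M] {m lF η : ℕ} (α β γ ρ lam : ℝ) (a e : Fin M → Bool)
    (x u z : Freq m lF → Fin M → ℂ) (w : Fin M → Fin lF → Pair m η → ℂ) :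
    Fin M → Freq m lF → ℂ := fun k =>
  fronthaul γ lam (fun f => sicSignal α β ρ a e x u z f k) (w k)

/-- The statistical model of one minislot: URLLC activities `A_k ∼ ℬ(q)`, decoding error
indicators `E_k ∼ ℬ(q ε)` (no assumption on the joint law of all these indicators), i.i.d.
eMBB symbols `𝒞𝒩(0, PB)`, i.i.d. URLLC symbols `𝒞𝒩(0, PU)`, white radio noise and white cable
noise of unit power; the indicators and the four signals are mutually independent. -/
structure IsMinislotModel {Ω : Type*} [MeasurableSpace Ω] (P : Measure Ω) {M m lF η : ℕ}
    (q ε PB PU : ℝ) (A E : Ω → Fin M → Bool) (X U Z : Ω → Freq m lF → Fin M → ℂ)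
    (W : Ω → Fin M → Fin lF → Pair m η → ℂ) : Prop where
  measurable_A : Measurable A
  measurable_E : Measurable E
  measurable_X : Measurable X
  measurable_U : Measurable U
  measurable_Z : Measurable Z
  measurable_W : Measurable W
  prob_A : ∀ k, P {ω | A ω k = true} = ENNReal.ofReal q
  prob_E : ∀ k, P {ω | E ω k = true} = ENNReal.ofReal (q * ε)
  law_X : P.map X = iidComplexGaussian (Freq m lF) (Fin M) PB
  law_U : P.map U = iidComplexGaussian (Freq m lF) (Fin M) PU
  law_Z : P.map Z = iidComplexGaussian (Freq m lF) (Fin M) 1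
  law_W : P.map W = Measure.pi fun _ : Fin M => iidComplexGaussian (Fin lF) (Pair m η) 1
  indep_AE : IndepFun (fun ω => (A ω, E ω)) (fun ω => (X ω, U ω, Z ω, W ω)) P
  indep_X : IndepFun X (fun ω => (U ω, Z ω, W ω)) P
  indep_U : IndepFun U (fun ω => (Z ω, W ω)) P
  indep_Z : IndepFun Z W P

/-- The eMBB per-user rate in bits per radio resource: the conditional mutual information, in
bits, between all eMBB signals and the signal at the BBU, given the URLLC activities and decoding
errors, divided by the number `nF = m * lF` of frequencies and the number `M` of users. -/
def eMBBRate {Ω : Type*} [MeasurableSpace Ω] (P : Measure Ω) {M : ℕ} [NeZero M] {m lF η : ℕ}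
    (α β γ ρ lam : ℝ) (A E : Ω → Fin M → Bool) (X U Z : Ω → Freq m lF → Fin M → ℂ)
    (W : Ω → Fin M → Fin lF → Pair m η → ℂ) : ℝ≥0∞ :=
  condMutualInfo P X
      (fun ω => bbuSignal α β γ ρ lam (A ω) (E ω) (X ω) (U ω) (Z ω) (W ω))
      (fun ω => (A ω, E ω))
    / ENNReal.ofReal (Real.log 2) / ((m * lF * M : ℕ) : ℝ≥0∞)

/-! ### Matrices of the rate formula -/

/-- The equivalent fronthaul channel `H_c^η = γ η 1 1ᵀ + (1 - γ) I`. -/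
def eqCableChannel (m η : ℕ) (γ : ℝ) : Matrix (Fin m) (Fin m) ℝ :=
  (γ * η) • Matrix.of (fun _ _ => 1) + (1 - γ) • 1

/-- `R_zeq = I_M ⊗ H_c^η H_c^η + (1 / (λ² η)) I`. -/
def noiseCov (M m η : ℕ) (γ lam : ℝ) : Matrix (Fin M × Fin m) (Fin M × Fin m) ℝ :=
  (1 : Matrix (Fin M) (Fin M) ℝ) ⊗ₖ (eqCableChannel m η γ * eqCableChannel m η γ)
    + (1 / (lam ^ 2 * η)) • 1

/-- `R_AE = R_zeq + ρ² β² PU ((A (I - E)) ⊗ H_c^η H_c^η)`. -/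
def sicNoiseCov {M : ℕ} (m η : ℕ) (β γ ρ lam PU : ℝ) (a e : Fin M → Bool) :
    Matrix (Fin M × Fin m) (Fin M × Fin m) ℝ :=
  noiseCov M m η γ lam + (ρ ^ 2 * β ^ 2 * PU) •
    ((diagBin a * (1 - diagBin e)) ⊗ₖ (eqCableChannel m η γ * eqCableChannel m η γ))

/-- `H_AE = ((I - A E) H) ⊗ H_c^η`. -/
def sicChannel {M : ℕ} [NeZero M] (m η : ℕ) (α γ : ℝ) (a e : Fin M → Bool) :
    Matrix (Fin M × Fin m) (Fin M × Fin m) ℝ :=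
  ((1 - diagBin a * diagBin e) * radioChannel M α) ⊗ₖ eqCableChannel m η γ

/-- `det (I + PB R_AE⁻¹ H_AE H_AEᵀ)`. -/
def sicDet {M : ℕ} [NeZero M] (m η : ℕ) (α β γ ρ lam PB PU : ℝ) (a e : Fin M → Bool) : ℝ :=
  (1 + PB • ((sicNoiseCov m η β γ ρ lam PU a e)⁻¹ *
    (sicChannel m η α γ a e * (sicChannel m η α γ a e).transpose))).det

end CRAN

end

/-! Fix a value `(a, e)` of `(A, E)`. By independence, conditioning on it does not change the joint
law of the four signals, and the received signal becomes `Y = T X + N` with `T` linear and `N`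
Gaussian, independent of `X`. For such a channel the mutual information is `h(Y) - h(N)`
(`klDiv_additiveNoise`). Only `Y` and `N` need densities, so `X` may be degenerate (`PB = 0`).

The maps applied to `X`, `U`, `Z` are real matrices on the (cell, sub-band) coordinates, the same at
each of the `lF` frequencies. Hence `N` and `Y` consist of `lF` independent circular Gaussian
vectors, with covariances `λ² R_AE` and `λ² (R_AE + PB H_AE H_AEᵀ)`. Characteristic functions
establish this, since they add up even when single terms have singular covariance.

The averaged cable noise makes both covariances positive definite. A circular Gaussian law with
covariance `R = S Sᵀ` is then the image under `S` of the standard one, and the change of variables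
adds `lF log det R` to the entropy `h₀` of the standard array (`IsCircularGaussian.hasDiffEntropy`).
In `h(Y) - h(N)` both `h₀` and the powers of `λ` cancel, which leaves `lF log sicDet`. It remains to
average over `(a, e)` and to normalize. -/

/-- `μ` has a positive density with respect to `ν`, and differential entropy `h` relative to
`ν`. -/
def HasDiffEntropy {α : Type*} [MeasurableSpace α] (μ ν : Measure α) (h : ℝ) : Prop :=
  ∃ p : α → ℝ, Measurable p ∧ (∀ x, 0 < p x) ∧
    μ = ν.withDensity (fun x => ENNReal.ofReal (p x)) ∧
    Integrable (fun x => Real.log (p x)) μ ∧ ∫ x, Real.log (p x) ∂μ = -h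

/-! ### Differential entropy under products and changes of variables. -/

namespace HasDiffEntropy

variable {α β : Type*} [MeasurableSpace α] [MeasurableSpace β]

lemma prod {μ ν : Measure α} {μ' ν' : Measure β} {h h' : ℝ} [IsProbabilityMeasure μ]
    [IsProbabilityMeasure μ'] [SFinite ν] [SFinite ν']
    (H : HasDiffEntropy μ ν h) (H' : HasDiffEntropy μ' ν' h') :
    HasDiffEntropy (μ.prod μ') (ν.prod ν') (h + h') := by
  obtain ⟨p, hp, hp0, hpd, hpi, hpe⟩ := H
  obtain ⟨p', hp', hp0', hpd', hpi', hpe'⟩ := H'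
  have hlog : (fun z : α × β => Real.log (p z.1 * p' z.2)) =
      fun z => Real.log (p z.1) + Real.log (p' z.2) := by
    funext z
    exact Real.log_mul (hp0 _).ne' (hp0' _).ne'
  have i1 := hpi.comp_fst μ'
  have i2 := hpi'.comp_snd μ
  refine ⟨fun z => p z.1 * p' z.2, by fun_prop, fun z => mul_pos (hp0 _) (hp0' _), ?_, ?_, ?_⟩
  · conv_lhs => rw [hpd, hpd']
    rw [prod_withDensity (by fun_prop) (by fun_prop)]
    congr with z
    rw [ENNReal.ofReal_mul (hp0 _).le]
  · rw [hlog]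
    exact i1.add i2
  · rw [hlog, integral_add i1 i2]
    have e1 := integral_fun_fst (μ := μ) (ν := μ') (fun x => Real.log (p x))
    have e2 := integral_fun_snd (μ := μ) (ν := μ') (fun x => Real.log (p' x))
    rw [e1, e2, hpe, hpe']
    simp
    ring

lemma map_measurableEquiv {μ ν : Measure α} {ν' : Measure β} {h : ℝ} (H : HasDiffEntropy μ ν h)
    (e : α ≃ᵐ β) (he : MeasurePreserving e ν ν') : HasDiffEntropy (μ.map e) ν' h := by
  obtain ⟨p, hp, hp0, hpd, hpi, hpe⟩ := H
  refine ⟨fun x => p (e.symm x), by fun_prop, fun z => hp0 _, ?_, ?_, ?_⟩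
  · ext s hs
    rw [Measure.map_apply e.measurable hs, hpd, withDensity_apply _ (e.measurable hs),
      withDensity_apply _ hs, ← he.setLIntegral_comp_preimage hs (by fun_prop)]
    simp
  · rw [e.measurableEmbedding.integrable_map_iff]
    simpa [Function.comp_def] using hpi
  · rw [e.measurableEmbedding.integral_map]
    simpa using hpe

lemma pi {ι : Type*} [Fintype ι] {μ ν : ι → Measure α} {h : ι → ℝ}
    [∀ i, IsProbabilityMeasure (μ i)] [∀ i, SigmaFinite (ν i)]
    (H : ∀ i, HasDiffEntropy (μ i) (ν i) (h i)) :
    HasDiffEntropy (Measure.pi μ) (Measure.pi ν) (∑ i, h i) := by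
  choose p hp hp0 hpd hpi hpe using H
  -- A density of a probability measure has integral one; integrability is what allows the integral
  -- of a product over a box to be factored below.
  have hint : ∀ i, Integrable (p i) (ν i) := fun i => by
    refine ⟨(hp i).aestronglyMeasurable, ?_⟩
    rw [hasFiniteIntegral_iff_ofReal (.of_forall fun x => (hp0 i x).le)]
    have : (μ i) Set.univ = 1 := measure_univ
    rw [hpd i, withDensity_apply _ .univ, Measure.restrict_univ] at this
    simp [this]
  have hlog : (fun z : ι → α => Real.log (∏ i, p i (z i))) =
      fun z => ∑ i, Real.log (p i (z i)) := by
    funext z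
    exact Real.log_prod fun i _ => (hp0 i _).ne'
  have hi : ∀ i, Integrable (fun z : ι → α => Real.log (p i (z i))) (Measure.pi μ) := fun i =>
    integrable_comp_eval (X := fun _ => α) (f := fun x => Real.log (p i x)) (hpi i)
  refine ⟨fun z => ∏ i, p i (z i), by fun_prop, fun z => Finset.prod_pos fun i _ => hp0 i _,
    ?_, ?_, ?_⟩
  · refine Measure.pi_eq fun s hs => ?_
    rw [withDensity_apply _ (.univ_pi hs), Measure.restrict_pi_pi,
      ← ofReal_integral_eq_lintegral_ofReal, integral_fintype_prod_eq_prod,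
      ENNReal.ofReal_prod_of_nonneg]
    · refine Finset.prod_congr rfl fun i _ => ?_
      rw [hpd i, withDensity_apply _ (hs i), ofReal_integral_eq_lintegral_ofReal]
      · exact (hint i).restrict
      · exact .of_forall fun x => (hp0 i x).le
    · exact fun i _ => integral_nonneg fun x => (hp0 i x).le
    · exact Integrable.fintype_prod fun i => (hint i).restrict
    · exact .of_forall fun x => Finset.prod_nonneg fun i _ => (hp0 i _).le
  · rw [hlog]
    exact integrable_finsetSum _ fun i _ => hi i
  · rw [hlog, integral_finsetSum _ fun i _ => hi i, ← Finset.sum_neg_distrib]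
    refine Finset.sum_congr rfl fun i _ => ?_
    rw [← hpe i]
    exact integral_comp_eval (X := fun _ => α) (f := fun x => Real.log (p i x)) (hp i).log.aestronglyMeasurable

/-- The image has density `|det f|⁻¹ * p ∘ f⁻¹`, so the log-density shifts by the constant `-log
|det f|`, which enters the entropy with the opposite sign. -/
lemma map_linearEquiv {E : Type*} [NormedAddCommGroup E] [NormedSpace ℝ E] [MeasurableSpace E]
    [BorelSpace E] [FiniteDimensional ℝ E] {μ ν : Measure E} [ν.IsAddHaarMeasure] {h : ℝ}
    (H : HasDiffEntropy μ ν h) [IsProbabilityMeasure μ] (f : E →ₗ[ℝ] E) (hf : LinearMap.det f ≠ 0) :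
    HasDiffEntropy (μ.map f) ν (h + Real.log |LinearMap.det f|) := by
  obtain ⟨p, hp, hp0, hpd, hpi, hpe⟩ := H
  let e : E ≃ᵐ E := (LinearEquiv.ofIsUnitDet (f := f) (v := Module.finBasis ℝ E)
    (v' := Module.finBasis ℝ E) (by simpa using hf)).toContinuousLinearEquiv.toHomeomorph.toMeasurableEquiv
  have hef : ∀ x, e x = f x := fun x => rfl
  have hef' : (f : E → E) = e := rfl
  have hd : 0 < |LinearMap.det f| := abs_pos.2 hf
  have hmap : ν.map e = ENNReal.ofReal |LinearMap.det f|⁻¹ • ν := by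
    rw [← hef', Measure.map_linearMap_addHaar_eq_smul_addHaar ν hf, abs_inv]
  have hlog : (fun x => Real.log (|LinearMap.det f|⁻¹ * p x)) =
      fun x => -Real.log |LinearMap.det f| + Real.log (p x) := by
    funext x
    rw [Real.log_mul (by positivity) (hp0 _).ne', Real.log_inv]
  rw [hef']
  refine ⟨fun x => |LinearMap.det f|⁻¹ * p (e.symm x), by fun_prop,
    fun z => mul_pos (by positivity) (hp0 _), ?_, ?_, ?_⟩
  · ext s hs
    have h1 : ν = ENNReal.ofReal |LinearMap.det f| • ν.map e := by
      rw [hmap, smul_smul, ← ENNReal.ofReal_mul hd.le, mul_inv_cancel₀ hd.ne']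
      simp
    rw [Measure.map_apply e.measurable hs, hpd, withDensity_apply _ (e.measurable hs),
      withDensity_apply _ hs]
    conv_rhs => rw [h1]
    rw [Measure.restrict_smul, lintegral_smul_measure, e.restrict_map, lintegral_map_equiv]
    simp only [e.symm_apply_apply]
    simp_rw [ENNReal.ofReal_mul (inv_nonneg.2 hd.le)]
    rw [lintegral_const_mul _ (by fun_prop), smul_eq_mul, ← mul_assoc, ← ENNReal.ofReal_mul hd.le,
      mul_inv_cancel₀ hd.ne']
    simp
  · rw [e.measurableEmbedding.integrable_map_iff]
    simp only [Function.comp_def, e.symm_apply_apply, hlog]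
    exact (integrable_const _).add hpi
  · rw [e.measurableEmbedding.integral_map]
    simp only [e.symm_apply_apply, hlog]
    rw [integral_add (integrable_const _) hpi, hpe]
    simp

end HasDiffEntropy

/-! ### Gaussian entropies and additive noise channels. -/

/-- The log-density is a quadratic polynomial, integrable because second moments are finite. The
value of `h` is left unspecified since it cancels in the end. -/
lemma hasDiffEntropy_gaussianReal (m : ℝ) {v : NNReal} (hv : v ≠ 0) :
    ∃ h, HasDiffEntropy (gaussianReal m v) volume h := by
  refine ⟨-∫ x, Real.log (gaussianPDFReal m v x) ∂(gaussianReal m v), gaussianPDFReal m v,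
    measurable_gaussianPDFReal m v, fun x => gaussianPDFReal_pos m v x hv,
    gaussianReal_of_var_ne_zero m hv, ?_, by simp⟩
  have : (fun x => Real.log (gaussianPDFReal m v x)) =
      fun x => Real.log (√(2 * Real.pi * v))⁻¹ + (-(x - m) ^ 2 / (2 * v)) := by
    funext x
    have : (0 : ℝ) < v := by positivity
    rw [gaussianPDFReal, Real.log_mul (by positivity) (Real.exp_pos _).ne', Real.log_exp]
  rw [this]
  have h2 : MemLp (fun x => x - m) 2 (gaussianReal m v) :=
    (memLp_id_gaussianReal 2).sub (memLp_const m)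
  exact (integrable_const _).add (h2.integrable_sq.neg.div_const _)

namespace CRAN

lemma hasDiffEntropy_complexGaussian {v : ℝ} (hv : 0 < v) :
    ∃ h, HasDiffEntropy (complexGaussian v) volume h := by
  obtain ⟨h, H⟩ := hasDiffEntropy_gaussianReal 0 (v := (v / 2).toNNReal)
    (by simpa using half_pos hv)
  refine ⟨h + h, (H.prod H).map_measurableEquiv Complex.measurableEquivRealProd.symm ?_⟩
  exact Complex.volume_preserving_equiv_real_prod.symm

instance isProbabilityMeasure_complexGaussian (v : ℝ) :
    IsProbabilityMeasure (complexGaussian v) := by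
  refine Measure.isProbabilityMeasure_map ?_
  exact Complex.measurableEquivRealProd.symm.measurable.aemeasurable

instance isProbabilityMeasure_iidComplexGaussian (ι κ : Type*) [Fintype ι] [Fintype κ] (v : ℝ) :
    IsProbabilityMeasure (iidComplexGaussian ι κ v) := by
  unfold iidComplexGaussian
  infer_instance

lemma hasDiffEntropy_iidComplexGaussian (ι κ : Type*) [Fintype ι] [Fintype κ] {v : ℝ}
    (hv : 0 < v) : ∃ h, HasDiffEntropy (iidComplexGaussian ι κ v) volume h := by
  obtain ⟨h, H⟩ := hasDiffEntropy_complexGaussian hv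
  exact ⟨_, .pi fun _ => .pi fun _ => H⟩

end CRAN

/-- The mutual information of an additive noise channel is the entropy of the output minus the
entropy of the noise. -/
lemma klDiv_additiveNoise {α E : Type*} [MeasurableSpace α] [MeasurableSpace E]
    [AddGroup E] [MeasurableAdd₂ E] [MeasurableNeg E] {ν : Measure E} [SigmaFinite ν] [ν.IsAddLeftInvariant]
    {μ : Measure α} [IsProbabilityMeasure μ] {κ : Measure E} [IsProbabilityMeasure κ]
    {T : α → E} (hT : Measurable T) {hN hY : ℝ} (HN : HasDiffEntropy κ ν hN)
    (HY : HasDiffEntropy ((μ.prod κ).map fun z => T z.1 + z.2) ν hY) :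
    InformationTheory.klDiv ((μ.prod κ).map fun z => (z.1, T z.1 + z.2))
        (μ.prod ((μ.prod κ).map fun z => T z.1 + z.2)) ≠ ∞ ∧
      (InformationTheory.klDiv ((μ.prod κ).map fun z => (z.1, T z.1 + z.2))
        (μ.prod ((μ.prod κ).map fun z => T z.1 + z.2))).toReal = hY - hN := by
  obtain ⟨p, hp, hp0, hpd, hpi, hpe⟩ := HN
  obtain ⟨r, hr, hr0, hrd, hri, hre⟩ := HY
  have hmS : Measurable fun z : α × E => T z.1 + z.2 := by fun_prop
  have hmJ : Measurable fun z : α × E => (z.1, T z.1 + z.2) := by fun_prop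
  set κY := (μ.prod κ).map fun z => T z.1 + z.2 with hκY
  set J := (μ.prod κ).map fun z => (z.1, T z.1 + z.2) with hJ
  have : IsProbabilityMeasure κY := Measure.isProbabilityMeasure_map hmS.aemeasurable
  have : IsProbabilityMeasure J := Measure.isProbabilityMeasure_map hmJ.aemeasurable
  -- Density of the joint law with respect to the product of marginals: given `x`, the output has
  -- density `p` translated by `T x`.
  let g : α × E → ℝ := fun z => p (-T z.1 + z.2) / r z.2
  have hg : Measurable g := by fun_prop
  have hg0 : ∀ z, 0 < g z := fun z => div_pos (hp0 _) (hr0 _)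
  have hprodY : μ.prod κY = (μ.prod ν).withDensity (fun z => ENNReal.ofReal (r z.2)) := by
    conv_lhs => rw [hrd]
    rw [prod_withDensity_right (by fun_prop)]
  -- The shear translates each fibre, so invariance of `ν` suffices.
  have hskew : MeasurePreserving (fun z : α × E => (z.1, T z.1 + z.2)) (μ.prod ν) (μ.prod ν) :=
    (MeasurePreserving.id μ).skew_product (g := fun a y => T a + y) hmS
      (.of_forall fun a => map_add_left_eq_self ν (T a))
  have hJd : J = (μ.prod κY).withDensity (fun z => ENNReal.ofReal (g z)) := by
    rw [hprodY, ← withDensity_mul _ (by fun_prop) (by fun_prop)]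
    have : ((fun z : α × E => ENNReal.ofReal (r z.2)) * fun z => ENNReal.ofReal (g z)) =
        fun z => ENNReal.ofReal (p (-T z.1 + z.2)) := by
      funext z
      simp only [Pi.mul_apply, g]
      rw [← ENNReal.ofReal_mul (hr0 _).le, mul_div_cancel₀ _ (hr0 _).ne']
    rw [this]
    ext s hs
    have h1 : μ.prod κ = (μ.prod ν).withDensity (fun z => ENNReal.ofReal (p z.2)) := by
      conv_lhs => rw [hpd]
      rw [prod_withDensity_right (by fun_prop)]
    rw [hJ, Measure.map_apply hmJ hs, h1, withDensity_apply _ (hmJ hs), withDensity_apply _ hs,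
      ← hskew.setLIntegral_comp_preimage hs (by fun_prop)]
    simp
  have hac : J ≪ μ.prod κY := hJd ▸ withDensity_absolutelyContinuous _ _
  have hll : llr J (μ.prod κY) =ᵐ[J]
      fun z => Real.log (p (-T z.1 + z.2)) - Real.log (r z.2) := by
    have h1 : J.rnDeriv (μ.prod κY) =ᵐ[μ.prod κY] fun z => ENNReal.ofReal (g z) := by
      conv_lhs => rw [hJd]
      exact Measure.rnDeriv_withDensity _ (by fun_prop)
    filter_upwards [hac.ae_le h1] with z hz
    rw [llr, hz, ENNReal.toReal_ofReal (hg0 z).le]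
    exact Real.log_div (hp0 _).ne' (hr0 _).ne'
  -- Subtracting `T x` from the output recovers the noise, so the two halves of the log-likelihood
  -- ratio integrate to `-hN` and `-hY`.
  have mp1 : MeasurePreserving (fun z : α × E => -T z.1 + z.2) J κ := by
    refine ⟨by fun_prop, ?_⟩
    rw [hJ, Measure.map_map (by fun_prop) hmJ]
    have : (fun z : α × E => -T z.1 + z.2) ∘ (fun z : α × E => (z.1, T z.1 + z.2)) = Prod.snd := by
      funext z; simp
    rw [this]
    exact measurePreserving_snd.map_eq
  have mp2 : MeasurePreserving (fun z : α × E => z.2) J κY := by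
    refine ⟨by fun_prop, ?_⟩
    rw [hJ, Measure.map_map (by fun_prop) hmJ]
    rfl
  have i1 : Integrable (fun z : α × E => Real.log (p (-T z.1 + z.2))) J :=
    mp1.integrable_comp_of_integrable hpi
  have i2 : Integrable (fun z : α × E => Real.log (r z.2)) J :=
    mp2.integrable_comp_of_integrable hri
  have hint : Integrable (llr J (μ.prod κY)) J := (integrable_congr hll).2 (i1.sub i2)
  refine ⟨InformationTheory.klDiv_ne_top hac hint, ?_⟩
  rw [InformationTheory.toReal_klDiv_of_measure_eq hac (by simp), integral_congr_ae hll,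
    integral_sub i1 i2]
  have e1 : ∫ z : α × E, Real.log (p (-T z.1 + z.2)) ∂J = -hN := by
    rw [← hpe, ← mp1.map_eq, integral_map mp1.measurable.aemeasurable
      hp.log.aestronglyMeasurable]
  have e2 : ∫ z : α × E, Real.log (r z.2) ∂J = -hY := by
    rw [← hre]
    conv_rhs => rw [← mp2.map_eq]
    rw [integral_map mp2.measurable.aemeasurable hr.log.aestronglyMeasurable]
  rw [e1, e2]
  ring

/-! ### Circular Gaussian laws through characteristic functions. -/

namespace CRAN

lemma charFunDual_gaussianReal_zero (v : NNReal) (L : StrongDual ℝ ℝ) :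
    charFunDual (gaussianReal 0 v) L = Complex.exp (-((v : ℝ) * L 1 ^ 2 / 2 : ℝ)) := by
  have h : ∀ x, L x = L 1 * x := fun x => by
    have := L.map_smul x 1
    rw [smul_eq_mul, smul_eq_mul, mul_one] at this
    rw [this, mul_comm]
  have : charFunDual (gaussianReal 0 v) L = charFun (gaussianReal 0 v) (L 1) := by
    rw [charFun_apply_real, charFunDual_apply]
    refine integral_congr_ae (.of_forall fun x => ?_)
    simp only
    rw [h x, Complex.ofReal_mul]
  rw [this, charFun_gaussianReal]
  congr 1
  push_cast
  ring

/-- The factor `1/4` is the `1/2` of the Gaussian characteristic function times the variance `v/2`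
of each real coordinate. -/
lemma charFunDual_complexGaussian {v : ℝ} (hv : 0 ≤ v) (L : StrongDual ℝ ℂ) :
    charFunDual (complexGaussian v) L =
      Complex.exp (-(v / 4 * (L 1 ^ 2 + L Complex.I ^ 2) : ℝ)) := by
  have : complexGaussian v = ((gaussianReal 0 (v / 2).toNNReal).prod
      (gaussianReal 0 (v / 2).toNNReal)).map
        (Complex.equivRealProdCLM.symm : ℝ × ℝ →L[ℝ] ℂ) := rfl
  rw [this, charFunDual_map, charFunDual_prod, charFunDual_gaussianReal_zero,
    charFunDual_gaussianReal_zero, ← Complex.exp_add]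
  have hv2 : ((v / 2).toNNReal : ℝ) = v / 2 := Real.coe_toNNReal _ (by positivity)
  have h1 : Complex.equivRealProdCLM.symm ((1 : ℝ), (0 : ℝ)) = 1 := by
    apply Complex.ext <;> simp
  have h2 : Complex.equivRealProdCLM.symm ((0 : ℝ), (1 : ℝ)) = Complex.I := by
    apply Complex.ext <;> simp
  simp only [ContinuousLinearMap.comp_apply, ContinuousLinearMap.inl_apply,
    ContinuousLinearMap.inr_apply, ContinuousLinearEquiv.coe_coe, h1, h2,
    hv2]
  congr 1
  push_cast
  ring

lemma charFunDual_iidComplexGaussian {ι κ : Type*} [Fintype ι] [Fintype κ] [DecidableEq ι]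
    [DecidableEq κ] {v : ℝ} (hv : 0 ≤ v) (L : StrongDual ℝ (ι → κ → ℂ)) :
    charFunDual (iidComplexGaussian ι κ v) L =
      Complex.exp (-(v / 4 * ∑ i, ∑ j, (L (Pi.single i (Pi.single j 1)) ^ 2 +
        L (Pi.single i (Pi.single j Complex.I)) ^ 2) : ℝ)) := by
  unfold iidComplexGaussian
  simp_rw [charFunDual_pi, charFunDual_complexGaussian hv, ← Complex.exp_sum]
  congr 1
  push_cast
  simp [Finset.mul_sum]

variable {M m lF η : ℕ}

/-- A real matrix acting on the (cell, sub-band) coordinates of `x`, frequency by frequency. -/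
def mixing (B : Matrix (Fin M × Fin m) (Fin M × Fin m) ℝ) :
    (Freq m lF → Fin M → ℂ) →ₗ[ℂ] (Fin M → Freq m lF → ℂ) where
  toFun x k f := ∑ p : Fin M × Fin m, (B (k, f.1) p : ℂ) * x (p.2, f.2) p.1
  map_add' x y := by
    funext k f
    simp [mul_add, Finset.sum_add_distrib]
  map_smul' c x := by
    funext k f
    simp only [Pi.smul_apply, smul_eq_mul, RingHom.id_apply, Finset.mul_sum]
    exact Finset.sum_congr rfl fun _ _ => by ring

/-- A real matrix acting on the (cell, sub-band) coordinates of `y`, frequency by frequency, as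
an endomorphism of the space of received signals. -/
def mixingEnd (B : Matrix (Fin M × Fin m) (Fin M × Fin m) ℝ) :
    (Fin M → Freq m lF → ℂ) →ₗ[ℂ] (Fin M → Freq m lF → ℂ) where
  toFun y k f := ∑ p : Fin M × Fin m, (B (k, f.1) p : ℂ) * y p.1 (p.2, f.2)
  map_add' x y := by
    funext k f
    simp [mul_add, Finset.sum_add_distrib]
  map_smul' c x := by
    funext k f
    simp only [Pi.smul_apply, smul_eq_mul, RingHom.id_apply, Finset.mul_sum]
    exact Finset.sum_congr rfl fun _ _ => by ring

/-- Averaging of the cable noise over the `η` replicas of each sub-band. -/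
noncomputable def averaging : (Fin M → Fin lF → Pair m η → ℂ) →ₗ[ℂ] (Fin M → Freq m lF → ℂ) where
  toFun w k f := (η : ℂ)⁻¹ * ∑ i, w k f.2 (f.1, i)
  map_add' x y := by
    funext k f
    simp [mul_add, Finset.sum_add_distrib]
  map_smul' c x := by
    funext k f
    simp only [Pi.smul_apply, smul_eq_mul, RingHom.id_apply, Finset.mul_sum]
    exact Finset.sum_congr rfl fun _ _ => by ring

/-- The coefficients of a functional on the directions `c` at frequency `f`. -/
noncomputable def coeffs (φ : StrongDual ℝ (Fin M → Freq m lF → ℂ)) (c : ℂ) (f : Fin lF) :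
    Fin M × Fin m → ℝ := fun p => φ (Pi.single p.1 (Pi.single (p.2, f) c))

open Matrix in
/-- The law of `lF` independent circularly symmetric complex Gaussian vectors with covariance
matrix `R`, described by its characteristic function. -/
def IsCircularGaussian (μ : Measure (Fin M → Freq m lF → ℂ))
    (R : Matrix (Fin M × Fin m) (Fin M × Fin m) ℝ) : Prop :=
  ∀ φ : StrongDual ℝ (Fin M → Freq m lF → ℂ), charFunDual μ φ =
    Complex.exp (-(1 / 4 * ∑ f, (coeffs φ 1 f ⬝ᵥ R *ᵥ coeffs φ 1 f +
      coeffs φ Complex.I f ⬝ᵥ R *ᵥ coeffs φ Complex.I f) : ℝ))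

lemma measurable_linearMap {E F : Type*} [NormedAddCommGroup E] [NormedSpace ℂ E]
    [FiniteDimensional ℂ E] [MeasurableSpace E] [BorelSpace E] [NormedAddCommGroup F]
    [NormedSpace ℂ F] [MeasurableSpace F] [BorelSpace F] (f : E →ₗ[ℂ] F) : Measurable f :=
  f.continuous_of_finiteDimensional.measurable

lemma charFunDual_map_linearMap {E F : Type*} [NormedAddCommGroup E] [NormedSpace ℂ E]
    [FiniteDimensional ℂ E] [MeasurableSpace E] [BorelSpace E] [NormedAddCommGroup F]
    [NormedSpace ℂ F] [MeasurableSpace F] [BorelSpace F] (f : E →ₗ[ℂ] F) (μ : Measure E)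
    (φ : StrongDual ℝ F) :
    charFunDual (μ.map f) φ =
      charFunDual μ (φ.comp (f.toContinuousLinearMap.restrictScalars ℝ)) :=
  charFunDual_map (f.toContinuousLinearMap.restrictScalars ℝ) φ

-- This is `‖Bᵀ a‖² = aᵀ B Bᵀ a`; it turns the sum of squares in a pulled-back characteristic
-- function into the covariance form.
open Matrix in
lemma sum_sq_vecMul {ι κ : Type*} [Fintype ι] [Fintype κ] (B : Matrix ι κ ℝ) (a : ι → ℝ) :
    ∑ q, (∑ p, B p q * a p) ^ 2 = a ⬝ᵥ (B * Bᵀ) *ᵥ a := by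
  rw [← Matrix.mulVec_mulVec, Matrix.dotProduct_mulVec, Matrix.mulVec_transpose]
  simp [dotProduct, Matrix.vecMul, sq, mul_comm]

lemma pi_single_pi_single_apply {ι κ : Type*} [DecidableEq ι] [DecidableEq κ] (i i' : ι)
    (j j' : κ) (c : ℂ) :
    (Pi.single i (Pi.single j c) : ι → κ → ℂ) i' j' = if i' = i ∧ j' = j then c else 0 := by
  by_cases h : i' = i
  · subst h
    by_cases h' : j' = j
    · subst h'; simp
    · simp [h']
  · simp [h]

lemma sum_smul_single (d : Fin M × Fin m → ℝ) (f : Fin lF) (c : ℂ) :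
    (∑ p, d p • (Pi.single p.1 (Pi.single (p.2, f) c) : Fin M → Freq m lF → ℂ)) =
      fun k g => if g.2 = f then (d (k, g.1) : ℂ) * c else 0 := by
  funext k g
  simp only [Finset.sum_apply, Pi.smul_apply, pi_single_pi_single_apply]
  obtain ⟨g1, g2⟩ := g
  rw [Finset.sum_eq_single (k, g1)]
  · by_cases h : g2 = f <;> simp [h]
  · intro p _ hp
    have : ¬(k = p.1 ∧ (g1, g2) = (p.2, f)) := by
      rintro ⟨rfl, h⟩
      apply hp
      simp only [Prod.mk.injEq] at h
      rw [h.1]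
    rw [if_neg this, smul_zero]
  · simp

lemma map_sum_smul_single (φ : StrongDual ℝ (Fin M → Freq m lF → ℂ)) (d : Fin M × Fin m → ℝ)
    (f : Fin lF) (c : ℂ) :
    φ (fun k g => if g.2 = f then (d (k, g.1) : ℂ) * c else 0) = ∑ p, d p * coeffs φ c f p := by
  rw [← sum_smul_single, map_sum]
  simp [coeffs]

/-- Pulling `φ` back along the mixing map applies `Bᵀ` to its coefficient vectors, separately at
each frequency. -/
lemma map_mixing_single (φ : StrongDual ℝ (Fin M → Freq m lF → ℂ))
    (B : Matrix (Fin M × Fin m) (Fin M × Fin m) ℝ) (f : Freq m lF) (k : Fin M) (c : ℂ) :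
    φ (mixing B (Pi.single f (Pi.single k c))) =
      ∑ p, B p (k, f.1) * coeffs φ c f.2 p := by
  rw [← map_sum_smul_single]
  congr 1
  funext k' g
  simp only [mixing, LinearMap.coe_mk, AddHom.coe_mk, pi_single_pi_single_apply]
  rw [Finset.sum_eq_single (k, f.1)]
  · obtain ⟨f1, f2⟩ := f
    by_cases h : g.2 = f2 <;> simp [h]
  · intro p _ hp
    rw [if_neg, mul_zero]
    rintro ⟨h, rfl⟩
    exact hp (by rw [← h])
  · simp

lemma map_mixingEnd_single (φ : StrongDual ℝ (Fin M → Freq m lF → ℂ))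
    (B : Matrix (Fin M × Fin m) (Fin M × Fin m) ℝ) (f : Freq m lF) (k : Fin M) (c : ℂ) :
    φ (mixingEnd B (Pi.single k (Pi.single f c))) =
      ∑ p, B p (k, f.1) * coeffs φ c f.2 p := by
  rw [← map_sum_smul_single]
  congr 1
  funext k' g
  simp only [mixingEnd, LinearMap.coe_mk, AddHom.coe_mk, pi_single_pi_single_apply]
  rw [Finset.sum_eq_single (k, f.1)]
  · obtain ⟨f1, f2⟩ := f
    by_cases h : g.2 = f2 <;> simp [h]
  · intro p _ hp
    rw [if_neg, mul_zero]
    rintro ⟨rfl, h⟩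
    exact hp (by rw [← h])
  · simp

lemma map_averaging_single (φ : StrongDual ℝ (Fin M → Freq m lF → ℂ)) (k : Fin M) (f : Fin lF)
    (i : Pair m η) (c : ℂ) :
    φ (averaging (Pi.single k (Pi.single f (Pi.single i c)))) =
      (η : ℝ)⁻¹ * coeffs φ c f (k, i.1) := by
  have h : averaging (Pi.single k (Pi.single f (Pi.single i c))) =
      (η : ℝ)⁻¹ • (Pi.single k (Pi.single (i.1, f) c) : Fin M → Freq m lF → ℂ) := by
    funext k' g
    simp only [averaging, LinearMap.coe_mk, AddHom.coe_mk, Pi.smul_apply,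
      pi_single_pi_single_apply]
    obtain ⟨g1, g2⟩ := g
    obtain ⟨i1, i2⟩ := i
    by_cases hk : k' = k
    · subst hk
      by_cases hf : g2 = f
      · subst hf
        by_cases hi : g1 = i1
        · subst hi
          simp [Pi.single_apply]
        · simp [hi]
      · simp [hf]
    · simp [hk]
  rw [h, map_smul]
  rfl

namespace IsCircularGaussian

lemma mixing {v : ℝ} (hv : 0 ≤ v) (B : Matrix (Fin M × Fin m) (Fin M × Fin m) ℝ) :
    IsCircularGaussian ((iidComplexGaussian (Freq m lF) (Fin M) v).map (mixing B))
      (v • (B * B.transpose)) := by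
  intro φ
  rw [charFunDual_map_linearMap, charFunDual_iidComplexGaussian hv]
  congr 3
  simp only [ContinuousLinearMap.comp_apply, ContinuousLinearMap.coe_restrictScalars',
    LinearMap.coe_toContinuousLinearMap', map_mixing_single]
  simp only [Matrix.smul_mulVec, dotProduct_smul, ← sum_sq_vecMul, smul_eq_mul, ← mul_add,
    ← Finset.sum_add_distrib, ← Finset.mul_sum, Fintype.sum_prod_type]
  rw [Finset.sum_comm, ← mul_assoc]
  congr 1
  · ring
  · refine Finset.sum_congr rfl fun f _ => ?_
    rw [Finset.sum_comm]

lemma mixingEnd (B : Matrix (Fin M × Fin m) (Fin M × Fin m) ℝ) :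
    IsCircularGaussian ((iidComplexGaussian (Fin M) (Freq m lF) 1).map (mixingEnd B))
      (B * B.transpose) := by
  intro φ
  rw [charFunDual_map_linearMap, charFunDual_iidComplexGaussian zero_le_one]
  congr 3
  simp only [ContinuousLinearMap.comp_apply, ContinuousLinearMap.coe_restrictScalars',
    LinearMap.coe_toContinuousLinearMap', map_mixingEnd_single]
  simp only [← sum_sq_vecMul, ← Finset.sum_add_distrib, Fintype.sum_prod_type]
  congr 1
  conv_rhs => rw [Finset.sum_comm]
  refine Finset.sum_congr rfl fun k _ => ?_
  rw [Finset.sum_comm]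

/-- Each of the `η` independent unit-variance replicas carries weight `η⁻¹`, so the mean has
variance `η * η⁻² = η⁻¹`. -/
lemma averaging (hη : 1 ≤ η) :
    IsCircularGaussian ((Measure.pi fun _ : Fin M =>
      iidComplexGaussian (Fin lF) (Pair m η) 1).map averaging) ((η : ℝ)⁻¹ • 1) := by
  intro φ
  rw [charFunDual_map_linearMap, charFunDual_pi]
  simp_rw [charFunDual_iidComplexGaussian zero_le_one]
  rw [← Complex.exp_sum]
  have hη0 : (η : ℝ) ≠ 0 := by positivity
  congr 1
  rw [Finset.sum_neg_distrib, ← Complex.ofReal_sum]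
  congr 2
  simp only [ContinuousLinearMap.comp_apply, ContinuousLinearMap.coe_restrictScalars',
    LinearMap.coe_toContinuousLinearMap', ContinuousLinearMap.single_apply, map_averaging_single]
  simp only [Matrix.smul_mulVec, Matrix.one_mulVec, dotProduct, Pi.smul_apply, smul_eq_mul,
    Fintype.sum_prod_type, ← Finset.mul_sum, Finset.sum_const, Finset.card_univ, Fintype.card_fin,
    nsmul_eq_mul, mul_pow, ← mul_add, ← Finset.sum_add_distrib]
  rw [Finset.sum_comm]
  congr 1
  simp only [Finset.mul_sum]
  refine Finset.sum_congr rfl fun f _ => Finset.sum_congr rfl fun k _ =>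
    Finset.sum_congr rfl fun j _ => ?_
  field_simp

lemma add {α β : Type*} [MeasurableSpace α] [MeasurableSpace β] {μ : Measure α} {ν : Measure β}
    [IsProbabilityMeasure μ] [IsProbabilityMeasure ν]
    {f : α → Fin M → Freq m lF → ℂ} {g : β → Fin M → Freq m lF → ℂ}
    (hf : Measurable f) (hg : Measurable g) {R R' : Matrix (Fin M × Fin m) (Fin M × Fin m) ℝ}
    (hR : IsCircularGaussian (μ.map f) R) (hR' : IsCircularGaussian (ν.map g) R') :
    IsCircularGaussian ((μ.prod ν).map fun z => f z.1 + g z.2) (R + R') := by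
  have := Measure.isProbabilityMeasure_map (μ := μ) hf.aemeasurable
  have := Measure.isProbabilityMeasure_map (μ := ν) hg.aemeasurable
  intro φ
  have h : (μ.prod ν).map (fun z => f z.1 + g z.2) = ((μ.map f).prod (ν.map g)).map
      (ContinuousLinearMap.fst ℝ (Fin M → Freq m lF → ℂ) (Fin M → Freq m lF → ℂ) +
        ContinuousLinearMap.snd ℝ (Fin M → Freq m lF → ℂ) (Fin M → Freq m lF → ℂ)) := by
    rw [Measure.map_prod_map _ _ hf hg, Measure.map_map (by fun_prop) (by fun_prop)]
    rfl
  rw [h, charFunDual_map, charFunDual_prod]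
  have h1 : (φ.comp (ContinuousLinearMap.fst ℝ (Fin M → Freq m lF → ℂ)
      (Fin M → Freq m lF → ℂ) + ContinuousLinearMap.snd ℝ (Fin M → Freq m lF → ℂ) (Fin M → Freq m lF → ℂ))).comp 
        (.inl ℝ (Fin M → Freq m lF → ℂ) (Fin M → Freq m lF → ℂ)) = φ := by
    ext; simp
  have h2 : (φ.comp (ContinuousLinearMap.fst ℝ (Fin M → Freq m lF → ℂ)
      (Fin M → Freq m lF → ℂ) + ContinuousLinearMap.snd ℝ (Fin M → Freq m lF → ℂ) (Fin M → Freq m lF → ℂ))).comp 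
        (.inr ℝ (Fin M → Freq m lF → ℂ) (Fin M → Freq m lF → ℂ)) = φ := by
    ext; simp
  rw [h1, h2, hR φ, hR' φ, ← Complex.exp_add]
  congr 1
  rw [← neg_add, ← Complex.ofReal_add, ← mul_add, ← Finset.sum_add_distrib]
  congr 4
  funext f
  simp only [Matrix.add_mulVec, dotProduct_add]
  ring

lemma unique {μ μ' : Measure (Fin M → Freq m lF → ℂ)} [IsFiniteMeasure μ] [IsFiniteMeasure μ']
    {R : Matrix (Fin M × Fin m) (Fin M × Fin m) ℝ} (h : IsCircularGaussian μ R)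
    (h' : IsCircularGaussian μ' R) : μ = μ' :=
  Measure.ext_of_charFunDual (funext fun φ => (h φ).trans (h' φ).symm)

end IsCircularGaussian

/-! ### Entropy of a nondegenerate circular Gaussian law. -/

/-- After regrouping coordinates as ((cell, sub-band), frequency), the map is the matrix `S ⊗ I`
with an identity of size `lF`. -/
lemma det_mixingEnd (S : Matrix (Fin M × Fin m) (Fin M × Fin m) ℝ) :
    LinearMap.det (mixingEnd (lF := lF) S) = ((S.det ^ lF : ℝ) : ℂ) := by
  let e : ((Fin M × Fin m) × Fin lF → ℂ) ≃ₗ[ℂ] (Fin M → Freq m lF → ℂ) :=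
    (LinearEquiv.funCongrLeft ℂ ℂ (Equiv.prodAssoc (Fin M) (Fin m) (Fin lF)).symm).trans
      (LinearEquiv.curry ℂ ℂ (Fin M) (Freq m lF))
  have he : mixingEnd (lF := lF) S = (e : _ →ₗ[ℂ] _) ∘ₗ
      Matrix.toLin' ((S.map Complex.ofReal) ⊗ₖ (1 : Matrix (Fin lF) (Fin lF) ℂ)) ∘ₗ
        (e.symm : _ →ₗ[ℂ] _) := by
    refine LinearMap.ext fun y => ?_
    funext k f
    change ∑ p : Fin M × Fin m, (S (k, f.1) p : ℂ) * y p.1 (p.2, f.2) =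
      ∑ q : (Fin M × Fin m) × Fin lF, ((S.map Complex.ofReal) ⊗ₖ
        (1 : Matrix (Fin lF) (Fin lF) ℂ)) ((k, f.1), f.2) q * y q.1.1 (q.1.2, q.2)
    conv_rhs => rw [Fintype.sum_prod_type]
    refine Finset.sum_congr rfl fun p _ => ?_
    simp [Matrix.one_apply]
  rw [he, LinearMap.det_conj, LinearMap.det_toLin', Matrix.det_kronecker]
  simp only [Matrix.det_one, one_pow, mul_one, Fintype.card_fin]
  rw [Complex.ofReal_pow]
  congr 1
  exact (Complex.ofRealHom.map_det S).symm

open scoped MatrixOrder in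
lemma exists_mul_transpose_eq {n : Type*} [Fintype n] [DecidableEq n] {R : Matrix n n ℝ}
    (hR : R.PosDef) : ∃ S : Matrix n n ℝ, S * S.transpose = R := by
  refine ⟨CFC.sqrt R, ?_⟩
  have h : (CFC.sqrt R).transpose = CFC.sqrt R := by
    have := (CFC.sqrt_nonneg R).isSelfAdjoint
    simpa [IsSelfAdjoint, Matrix.star_eq_conjTranspose] using this
  rw [h]
  exact CFC.sqrt_mul_sqrt_self R hR.posSemidef.nonneg

lemma IsCircularGaussian.hasDiffEntropy {μ : Measure (Fin M → Freq m lF → ℂ)}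
    [IsFiniteMeasure μ] {R : Matrix (Fin M × Fin m) (Fin M × Fin m) ℝ}
    (h : IsCircularGaussian μ R) (hR : R.PosDef) {h₀ : ℝ}
    (H : HasDiffEntropy (iidComplexGaussian (Fin M) (Freq m lF) 1) volume h₀) :
    HasDiffEntropy μ volume (h₀ + lF * Real.log R.det) := by
  obtain ⟨S, hS⟩ := exists_mul_transpose_eq hR
  have : (volume : Measure (Fin M → Freq m lF → ℂ)).IsAddHaarMeasure :=
    Measure.pi.isAddHaarMeasure _
  have hm : Measurable (CRAN.mixingEnd (lF := lF) S) := measurable_linearMap _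
  have : IsProbabilityMeasure ((iidComplexGaussian (Fin M) (Freq m lF) 1).map
    (CRAN.mixingEnd S)) := Measure.isProbabilityMeasure_map hm.aemeasurable
  have hμ : μ = (iidComplexGaussian (Fin M) (Freq m lF) 1).map (CRAN.mixingEnd S) :=
    h.unique (hS ▸ IsCircularGaussian.mixingEnd S)
  have hdet : R.det = S.det * S.det := by rw [← hS, Matrix.det_mul, Matrix.det_transpose]
  -- The real determinant of a complex-linear map is the squared modulus of its complex determinant,
  -- and `(det S)² = det R`. This is why no factor `1/2` precedes the logarithm.
  have hd : LinearMap.det ((CRAN.mixingEnd (lF := lF) S).restrictScalars ℝ) = R.det ^ lF := by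
    rw [LinearMap.det_restrictScalars, det_mixingEnd, Algebra.norm_complex_apply,
      Complex.normSq_ofReal, hdet, mul_pow]
  have key := H.map_linearEquiv ((CRAN.mixingEnd (lF := lF) S).restrictScalars ℝ)
    (by rw [hd]; exact (pow_pos hR.det_pos _).ne')
  rw [hd, abs_of_pos (pow_pos hR.det_pos _), Real.log_pow] at key
  rw [hμ]
  exact key

end CRAN

/-! ### The linear model of the received signal and its covariances. -/

namespace CRAN

variable {M m lF η : ℕ}

lemma eqCableChannel_transpose (m η : ℕ) (γ : ℝ) :
    (eqCableChannel m η γ).transpose = eqCableChannel m η γ := by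
  ext i j
  simp [eqCableChannel, Matrix.one_apply, eq_comm]

lemma fronthaul_apply (hη : 1 ≤ η) (γ lam : ℝ) (y : Freq m lF → ℂ)
    (w : Fin lF → Pair m η → ℂ) (f : Freq m lF) :
    fronthaul γ lam y w f = (lam : ℂ) * ∑ j, (eqCableChannel m η γ f.1 j : ℂ) * y (j, f.2) +
      (η : ℂ)⁻¹ * ∑ i, w f.2 (f.1, i) := by
  obtain ⟨j, f⟩ := f
  have hη0 : (η : ℂ) ≠ 0 := by exact_mod_cast (by omega : η ≠ 0)
  -- Crosstalk sums the `η` equal replicas of each sub-band, which produces the `γ η` of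
  -- `eqCableChannel`. The result does not depend on the replica index, so the combiner leaves it
  -- unchanged.
  have h1 : ∀ c : Pair m η, ∑ c' : Pair m η, y (c'.1, f) * (cableChannel m η γ c' c : ℂ) =
      ∑ j, (eqCableChannel m η γ c.1 j : ℂ) * y (j, f) := by
    intro c
    simp only [cableChannel, eqCableChannel, Matrix.add_apply, Matrix.smul_apply, Matrix.of_apply,
      smul_eq_mul, mul_one, Complex.ofReal_add, Complex.ofReal_mul, mul_add, add_mul,
      Finset.sum_add_distrib, Matrix.one_apply]
    congr 1
    · simp only [Fintype.sum_prod_type, Finset.sum_const, Finset.card_univ, Fintype.card_fin,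
        nsmul_eq_mul]
      refine Finset.sum_congr rfl fun j _ => ?_
      push_cast
      ring
    · simp only [apply_ite Complex.ofReal, Complex.ofReal_one, Complex.ofReal_zero, mul_ite,
        mul_one, mul_zero, ite_mul, zero_mul, Finset.sum_ite_eq, Finset.sum_ite_eq',
        Finset.mem_univ, if_true]
      exact mul_comm _ _
  simp only [fronthaul, Matrix.mul_apply, Matrix.add_apply, Matrix.map_apply, Matrix.smul_apply,
    cableMap, Matrix.of_apply, combiner, smul_eq_mul]
  simp only [mul_assoc, ← Finset.mul_sum, h1]
  rw [Fintype.sum_prod_type, Finset.sum_eq_single j]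
  · simp only [if_true, mul_one, Complex.ofReal_inv, Complex.ofReal_natCast, ← Finset.sum_mul,
      Finset.sum_add_distrib, Finset.sum_const, Finset.card_univ, Fintype.card_fin, nsmul_eq_mul]
    field_simp
  · intro j' _ hj
    simp [hj]
  · simp

lemma mixing_smul_kronecker_apply (c : ℝ) (D : Matrix (Fin M) (Fin M) ℝ)
    (B : Matrix (Fin m) (Fin m) ℝ) (x : Freq m lF → Fin M → ℂ) (k : Fin M) (f : Freq m lF) :
    mixing (c • (D ⊗ₖ B)) x k f =
      (c : ℂ) * ∑ j, (B f.1 j : ℂ) * ∑ k', (D k k' : ℂ) * x (j, f.2) k' := by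
  simp only [mixing, LinearMap.coe_mk, AddHom.coe_mk, Fintype.sum_prod_type, Matrix.smul_apply,
    Matrix.kronecker_apply, smul_eq_mul, Complex.ofReal_mul]
  rw [Finset.sum_comm]
  simp only [Finset.mul_sum]
  refine Finset.sum_congr rfl fun j _ => Finset.sum_congr rfl fun k' _ => ?_
  ring

lemma sum_radioChannel_mul [NeZero M] (α : ℝ) (x : Fin M → ℂ) (k : Fin M) :
    ∑ k', (radioChannel M α k k' : ℂ) * x k' =
      x k + (α : ℂ) * x (k + 1) + (α : ℂ) * x (k - 1) := by
  have h0 : ∀ k' : Fin M, k - k' = 0 ↔ k' = k := fun k' => by rw [sub_eq_zero, eq_comm]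
  have h1 : ∀ k' : Fin M, k - k' = 1 ↔ k' = k - 1 := fun k' => by
    rw [sub_eq_iff_eq_add, eq_sub_iff_add_eq, eq_comm, add_comm]
  have h2 : ∀ k' : Fin M, k - k' = -1 ↔ k' = k + 1 := fun k' => by
    rw [sub_eq_iff_eq_add, ← sub_eq_neg_add, eq_sub_iff_add_eq, eq_comm]
  simp only [radioChannel, Matrix.circulant_apply, h0, h1, h2, Complex.ofReal_add, add_mul,
    Finset.sum_add_distrib]
  simp only [apply_ite Complex.ofReal, Complex.ofReal_one, Complex.ofReal_zero, ite_mul, one_mul,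
    zero_mul, Finset.sum_ite_eq', Finset.mem_univ, if_true]
  ring

lemma diagBin_mul_diagBin (a e : Fin M → Bool) :
    diagBin a * (1 - diagBin e) =
      Matrix.diagonal fun k => (if a k then 1 else 0) * (1 - if e k then 1 else 0) := by
  rw [diagBin, diagBin, ← Matrix.diagonal_one, Matrix.diagonal_sub, Matrix.diagonal_mul_diagonal]

lemma one_sub_diagBin_mul_diagBin (a e : Fin M → Bool) :
    1 - diagBin a * diagBin e =
      Matrix.diagonal fun k => 1 - (if a k then 1 else 0) * (if e k then 1 else 0) := by
  rw [diagBin, diagBin, ← Matrix.diagonal_one, Matrix.diagonal_mul_diagonal, Matrix.diagonal_sub]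

lemma bbuSignal_eq [NeZero M] (hη : 1 ≤ η) (α β γ ρ lam : ℝ) (a e : Fin M → Bool)
    (x u z : Freq m lF → Fin M → ℂ) (w : Fin M → Fin lF → Pair m η → ℂ) :
    bbuSignal α β γ ρ lam a e x u z w =
      mixing (lam • sicChannel m η α γ a e) x +
        (mixing ((lam * ρ * β) • ((diagBin a * (1 - diagBin e)) ⊗ₖ eqCableChannel m η γ)) u +
          (mixing (lam • ((1 : Matrix (Fin M) (Fin M) ℝ) ⊗ₖ eqCableChannel m η γ)) z +
            averaging w)) := by
  funext k f
  simp only [bbuSignal, fronthaul_apply hη, Pi.add_apply, sicChannel, mixing_smul_kronecker_apply,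
    diagBin_mul_diagBin, one_sub_diagBin_mul_diagBin, Matrix.diagonal_mul, Complex.ofReal_mul,
    mul_assoc, ← Finset.mul_sum, sum_radioChannel_mul]
  simp only [Matrix.diagonal_apply, Matrix.one_apply, apply_ite Complex.ofReal, Complex.ofReal_zero,
    Complex.ofReal_one, ite_mul, zero_mul, one_mul, Finset.sum_ite_eq, Finset.mem_univ, if_true]
  rw [← add_assoc, ← add_assoc]
  congr 1
  simp only [Finset.mul_sum, ← Finset.sum_add_distrib]
  refine Finset.sum_congr rfl fun j _ => ?_
  simp only [sicSignal]
  push_cast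
  split_ifs <;> simp <;> ring

lemma posSemidef_eqCableChannel_sq (m η : ℕ) (γ : ℝ) :
    (eqCableChannel m η γ * eqCableChannel m η γ).PosSemidef := by
  have := Matrix.posSemidef_self_mul_conjTranspose (eqCableChannel m η γ)
  rwa [Matrix.conjTranspose_eq_transpose_of_trivial, eqCableChannel_transpose] at this

lemma posSemidef_diagBin (a e : Fin M → Bool) : (diagBin a * (1 - diagBin e)).PosSemidef := by
  rw [diagBin_mul_diagBin, Matrix.posSemidef_diagonal_iff]
  intro k
  split_ifs <;> simp

/-- Strict positivity comes from the cable noise term `1 / (λ² η)` alone; the other two terms may be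
singular. -/
lemma posDef_sicNoiseCov (hη : 1 ≤ η) (β γ ρ : ℝ) {lam PU : ℝ} (hlam : 0 < lam) (hPU : 0 ≤ PU)
    (a e : Fin M → Bool) : (sicNoiseCov m η β γ ρ lam PU a e).PosDef := by
  have hη0 : (0 : ℝ) < η := by exact_mod_cast hη
  refine Matrix.PosDef.add_posSemidef (Matrix.PosDef.posSemidef_add ?_ ?_) ?_
  · exact Matrix.PosSemidef.one.kronecker (posSemidef_eqCableChannel_sq m η γ)
  · exact Matrix.PosDef.one.smul (by positivity)
  · exact ((posSemidef_diagBin a e).kronecker (posSemidef_eqCableChannel_sq m η γ)).smul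
      (by positivity)

lemma posDef_sicNoiseCov_add [NeZero M] (hη : 1 ≤ η) (α β γ ρ : ℝ) {lam PB PU : ℝ}
    (hlam : 0 < lam) (hPB : 0 ≤ PB) (hPU : 0 ≤ PU) (a e : Fin M → Bool) :
    (sicNoiseCov m η β γ ρ lam PU a e +
      PB • (sicChannel m η α γ a e * (sicChannel m η α γ a e).transpose)).PosDef := by
  refine (posDef_sicNoiseCov hη β γ ρ hlam hPU a e).add_posSemidef (Matrix.PosSemidef.smul ?_ hPB)
  have := Matrix.posSemidef_self_mul_conjTranspose (sicChannel m η α γ a e)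
  rwa [Matrix.conjTranspose_eq_transpose_of_trivial] at this

/-- Multiplying `I + PB R⁻¹ H Hᵀ` on the left by `R` gives `R + PB H Hᵀ`, so the determinant is the
ratio of the output and noise covariance determinants. -/
lemma sicDet_eq_div [NeZero M] (hη : 1 ≤ η) (α β γ ρ : ℝ) {lam PU : ℝ} (PB : ℝ)
    (hlam : 0 < lam) (hPU : 0 ≤ PU) (a e : Fin M → Bool) :
    sicDet m η α β γ ρ lam PB PU a e = (sicNoiseCov m η β γ ρ lam PU a e +
      PB • (sicChannel m η α γ a e * (sicChannel m η α γ a e).transpose)).det /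
        (sicNoiseCov m η β γ ρ lam PU a e).det := by
  have hu : IsUnit (sicNoiseCov m η β γ ρ lam PU a e).det :=
    (posDef_sicNoiseCov hη β γ ρ hlam hPU a e).det_pos.ne'.isUnit
  rw [eq_div_iff hu.ne_zero, mul_comm, sicDet, ← Matrix.det_mul, Matrix.mul_add, Matrix.mul_one,
    Matrix.mul_smul, ← Matrix.mul_assoc, Matrix.mul_nonsing_inv _ hu, Matrix.one_mul]

lemma sicDet_pos [NeZero M] (hη : 1 ≤ η) (α β γ ρ : ℝ) {lam PB PU : ℝ} (hlam : 0 < lam)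
    (hPB : 0 ≤ PB) (hPU : 0 ≤ PU) (a e : Fin M → Bool) :
    0 < sicDet m η α β γ ρ lam PB PU a e := by
  rw [sicDet_eq_div hη α β γ ρ PB hlam hPU]
  exact div_pos (posDef_sicNoiseCov_add hη α β γ ρ hlam hPB hPU a e).det_pos
    (posDef_sicNoiseCov hη β γ ρ hlam hPU a e).det_pos

lemma noise_covariance_eq (m η : ℕ) (β γ ρ : ℝ) {lam : ℝ} (PU : ℝ) (hlam : 0 < lam)
    (a e : Fin M → Bool) :
    PU • (((lam * ρ * β) • ((diagBin a * (1 - diagBin e)) ⊗ₖ eqCableChannel m η γ)) *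
        ((lam * ρ * β) • ((diagBin a * (1 - diagBin e)) ⊗ₖ eqCableChannel m η γ)).transpose) +
      ((1 : ℝ) • ((lam • ((1 : Matrix (Fin M) (Fin M) ℝ) ⊗ₖ eqCableChannel m η γ)) *
        (lam • ((1 : Matrix (Fin M) (Fin M) ℝ) ⊗ₖ eqCableChannel m η γ)).transpose) +
          (η : ℝ)⁻¹ • 1) = lam ^ 2 • sicNoiseCov m η β γ ρ lam PU a e := by
  -- A diagonal matrix with entries 0 and 1 is idempotent, so the activity pattern enters the
  -- covariance unsquared.
  have hD : (diagBin a * (1 - diagBin e)) * (diagBin a * (1 - diagBin e)).transpose =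
      diagBin a * (1 - diagBin e) := by
    rw [diagBin_mul_diagBin, Matrix.diagonal_transpose, Matrix.diagonal_mul_diagonal]
    congr 1
    funext k
    split_ifs <;> simp
  have hD1 : (1 : Matrix (Fin M) (Fin M) ℝ) * Matrix.transpose 1 = 1 := by simp
  simp only [Matrix.transpose_smul, Matrix.smul_mul, Matrix.mul_smul, ← Matrix.kroneckerMap_transpose,
    ← Matrix.mul_kronecker_mul, hD, hD1, eqCableChannel_transpose, sicNoiseCov, noiseCov, smul_add,
    smul_smul]
  rw [add_comm]
  congr 1
  · congr 2
    · ring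
    · field_simp
  · congr 1
    ring

/-- Entropy of the received signal minus entropy of the total noise, for fixed activities and
decoding errors. -/
lemma klDiv_bbuSignal [NeZero M] (hη : 1 ≤ η) (α β γ ρ : ℝ) {lam PB PU : ℝ} (hlam : 0 < lam)
    (hPB : 0 ≤ PB) (hPU : 0 ≤ PU) (a e : Fin M → Bool)
    {ν : Measure ((Freq m lF → Fin M → ℂ) × (Freq m lF → Fin M → ℂ) × (Freq m lF → Fin M → ℂ) ×
      (Fin M → Fin lF → Pair m η → ℂ))}
    (hν : ν = (iidComplexGaussian (Freq m lF) (Fin M) PB).prod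
      ((iidComplexGaussian (Freq m lF) (Fin M) PU).prod
        ((iidComplexGaussian (Freq m lF) (Fin M) 1).prod
          (Measure.pi fun _ : Fin M => iidComplexGaussian (Fin lF) (Pair m η) 1)))) :
    InformationTheory.klDiv
        (ν.map fun s => (s.1, bbuSignal α β γ ρ lam a e s.1 s.2.1 s.2.2.1 s.2.2.2))
        ((iidComplexGaussian (Freq m lF) (Fin M) PB).prod
          (ν.map fun s => bbuSignal α β γ ρ lam a e s.1 s.2.1 s.2.2.1 s.2.2.2)) ≠ ∞ ∧
      (InformationTheory.klDiv
        (ν.map fun s => (s.1, bbuSignal α β γ ρ lam a e s.1 s.2.1 s.2.2.1 s.2.2.2))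
        ((iidComplexGaussian (Freq m lF) (Fin M) PB).prod
          (ν.map fun s => bbuSignal α β γ ρ lam a e s.1 s.2.1 s.2.2.1 s.2.2.2))).toReal =
        lF * Real.log (sicDet m η α β γ ρ lam PB PU a e) := by
  set μX := iidComplexGaussian (Freq m lF) (Fin M) PB
  set μU := iidComplexGaussian (Freq m lF) (Fin M) PU with hμU
  set μZ := iidComplexGaussian (Freq m lF) (Fin M) 1 with hμZ
  set μW := Measure.pi fun _ : Fin M => iidComplexGaussian (Fin lF) (Pair m η) 1 with hμW
  set Bx := lam • sicChannel m η α γ a e with hBx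
  set Bu := (lam * ρ * β) • ((diagBin a * (1 - diagBin e)) ⊗ₖ eqCableChannel m η γ) with hBu
  set Bz := lam • ((1 : Matrix (Fin M) (Fin M) ℝ) ⊗ₖ eqCableChannel m η γ) with hBz
  let N : (Freq m lF → Fin M → ℂ) × (Freq m lF → Fin M → ℂ) × (Fin M → Fin lF → Pair m η → ℂ) →
      (Fin M → Freq m lF → ℂ) := fun s => mixing Bu s.1 + (mixing Bz s.2.1 + averaging s.2.2)
  have mx : Measurable (mixing (lF := lF) Bx) := measurable_linearMap _
  have mu : Measurable (mixing (lF := lF) Bu) := measurable_linearMap _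
  have mz : Measurable (mixing (lF := lF) Bz) := measurable_linearMap _
  have mw : Measurable (averaging (M := M) (m := m) (lF := lF) (η := η)) := measurable_linearMap _
  have mzw : Measurable fun s : (Freq m lF → Fin M → ℂ) × (Fin M → Fin lF → Pair m η → ℂ) =>
    mixing Bz s.1 + averaging s.2 := (mz.comp measurable_fst).add (mw.comp measurable_snd)
  have mN : Measurable N := (mu.comp measurable_fst).add (mzw.comp measurable_snd)
  have gN : IsCircularGaussian ((μU.prod (μZ.prod μW)).map N)
      (lam ^ 2 • sicNoiseCov m η β γ ρ lam PU a e) := by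
    rw [← noise_covariance_eq m η β γ ρ PU hlam a e]
    exact (IsCircularGaussian.mixing hPU Bu).add mu mzw
      ((IsCircularGaussian.mixing zero_le_one Bz).add mz mw (IsCircularGaussian.averaging hη))
  set κ := (μU.prod (μZ.prod μW)).map N with hκ
  have : IsProbabilityMeasure κ := Measure.isProbabilityMeasure_map mN.aemeasurable
  have gY : IsCircularGaussian ((μX.prod κ).map fun z => mixing Bx z.1 + z.2)
      (lam ^ 2 • (sicNoiseCov m η β γ ρ lam PU a e +
        PB • (sicChannel m η α γ a e * (sicChannel m η α γ a e).transpose))) := by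
    have := (IsCircularGaussian.mixing hPB Bx).add (ν := κ) (g := fun y => y) mx measurable_id
      (by rwa [Measure.map_id'])
    convert this using 1
    rw [add_comm (PB • _), smul_add, hBx]
    simp only [Matrix.transpose_smul, Matrix.smul_mul, Matrix.mul_smul, smul_smul]
    congr 2
    ring
  -- All noise sources are merged into one variable of law `κ`, independent of `X`, to fit the
  -- additive noise channel.
  have hprod : μX.prod κ = ν.map (Prod.map id N) := by
    rw [hν, ← Measure.map_prod_map _ _ measurable_id mN, Measure.map_id]
  have hbbu : ∀ s : (Freq m lF → Fin M → ℂ) × (Freq m lF → Fin M → ℂ) × (Freq m lF → Fin M → ℂ) ×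
      (Fin M → Fin lF → Pair m η → ℂ), bbuSignal α β γ ρ lam a e s.1 s.2.1 s.2.2.1 s.2.2.2 =
        mixing Bx s.1 + N s.2 := fun s => bbuSignal_eq hη α β γ ρ lam a e _ _ _ _
  have mid : Measurable (Prod.map (id : (Freq m lF → Fin M → ℂ) → _) N) := measurable_id.prodMap mN
  have mS : Measurable fun z : (Freq m lF → Fin M → ℂ) × (Fin M → Freq m lF → ℂ) =>
    mixing Bx z.1 + z.2 := (mx.comp measurable_fst).add measurable_snd
  have e1 : (ν.map fun s => bbuSignal α β γ ρ lam a e s.1 s.2.1 s.2.2.1 s.2.2.2) =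
      (μX.prod κ).map fun z => mixing Bx z.1 + z.2 := by
    rw [hprod, Measure.map_map mS mid]
    simp only [hbbu]
    rfl
  have e2 : (ν.map fun s => (s.1, bbuSignal α β γ ρ lam a e s.1 s.2.1 s.2.2.1 s.2.2.2)) =
      (μX.prod κ).map fun z => (z.1, mixing Bx z.1 + z.2) := by
    rw [hprod, Measure.map_map (measurable_fst.prodMk mS) mid]
    simp only [hbbu]
    rfl
  have : (volume : Measure (Fin M → Freq m lF → ℂ)).IsAddHaarMeasure :=
    Measure.pi.isAddHaarMeasure _
  have : IsProbabilityMeasure ((μX.prod κ).map fun z => mixing Bx z.1 + z.2) :=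
    Measure.isProbabilityMeasure_map mS.aemeasurable
  obtain ⟨h₀, H₀⟩ := hasDiffEntropy_iidComplexGaussian (Fin M) (Freq m lF) one_pos
  have pN := posDef_sicNoiseCov (m := m) hη β γ ρ hlam hPU a e
  have pY := posDef_sicNoiseCov_add (m := m) hη α β γ ρ hlam hPB hPU a e
  have hl : 0 < lam ^ 2 := by positivity
  have key := klDiv_additiveNoise (μ := μX) mx (gN.hasDiffEntropy (pN.smul hl) H₀)
    (gY.hasDiffEntropy (pY.smul hl) H₀)
  rw [e1, e2]
  refine ⟨key.1, key.2.trans ?_⟩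
  -- Both covariances carry the same scalar `λ²` in the same dimension, so its contribution cancels
  -- together with `h₀`.
  rw [sicDet_eq_div hη α β γ ρ PB hlam hPU, Matrix.det_smul, Matrix.det_smul,
    Real.log_mul (by positivity) pY.det_pos.ne', Real.log_mul (by positivity) pN.det_pos.ne',
    Real.log_div pY.det_pos.ne' pN.det_pos.ne']
  ring

end CRAN

/-! ### Conditioning on activities and decoding errors, and averaging. -/

lemma map_cond_of_indepFun {Ω α σ : Type*} [MeasurableSpace Ω] [MeasurableSpace α]
    [MeasurableSpace σ] [MeasurableSingletonClass σ] {P : Measure Ω} [IsFiniteMeasure P]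
    {S : Ω → σ} {T : Ω → α} (hS : Measurable S) (hT : Measurable T) (h : IndepFun S T P) {s : σ}
    (hs : P (S ⁻¹' {s}) ≠ 0) : (P[|S ⁻¹' {s}]).map T = P.map T := by
  ext t ht
  have hm : MeasurableSet (S ⁻¹' {s}) := hS (measurableSet_singleton s)
  rw [Measure.map_apply hT ht, Measure.map_apply hT ht, cond_apply hm,
    h.measure_inter_preimage_eq_mul _ _ (measurableSet_singleton s) ht, ← mul_assoc,
    ENNReal.inv_mul_cancel hs (measure_ne_top _ _), one_mul]

lemma integral_comp_fintype {Ω σ : Type*} [MeasurableSpace Ω] [MeasurableSpace σ]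
    [MeasurableSingletonClass σ] [Fintype σ] (P : Measure Ω) [IsFiniteMeasure P] {S : Ω → σ}
    (hS : Measurable S) (g : σ → ℝ) :
    Integrable (fun ω => g (S ω)) P ∧
      ∫ ω, g (S ω) ∂P = ∑ s, (P (S ⁻¹' {s})).toReal * g s := by
  have hg : Integrable g (P.map S) := .of_finite
  refine ⟨hg.comp_measurable hS, ?_⟩
  rw [← integral_map (f := g) hS.aemeasurable hg.aestronglyMeasurable, integral_fintype hg]
  refine Finset.sum_congr rfl fun s _ => ?_
  rw [measureReal_def, Measure.map_apply hS (measurableSet_singleton s), smul_eq_mul]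

namespace CRAN

variable {M m lF η : ℕ}

lemma IsMinislotModel.map_signals {Ω : Type*} [MeasurableSpace Ω] {P : Measure Ω}
    [IsProbabilityMeasure P] {q ε PB PU : ℝ} {A E : Ω → Fin M → Bool}
    {X U Z : Ω → Freq m lF → Fin M → ℂ} {W : Ω → Fin M → Fin lF → Pair m η → ℂ}
    (h : IsMinislotModel P q ε PB PU A E X U Z W) :
    P.map (fun ω => (X ω, U ω, Z ω, W ω)) = (iidComplexGaussian (Freq m lF) (Fin M) PB).prod
      ((iidComplexGaussian (Freq m lF) (Fin M) PU).prod
        ((iidComplexGaussian (Freq m lF) (Fin M) 1).prod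
          (Measure.pi fun _ : Fin M => iidComplexGaussian (Fin lF) (Pair m η) 1))) := by
  have mX := h.measurable_X
  have mU := h.measurable_U
  have mZ := h.measurable_Z
  have mW := h.measurable_W
  rw [(indepFun_iff_map_prod_eq_prod_map_map mX.aemeasurable (by fun_prop)).1 h.indep_X,
    (indepFun_iff_map_prod_eq_prod_map_map mU.aemeasurable (by fun_prop)).1 h.indep_U,
    (indepFun_iff_map_prod_eq_prod_map_map mZ.aemeasurable mW.aemeasurable).1 h.indep_Z,
    h.law_X, h.law_U, h.law_Z, h.law_W]

lemma measurable_bbuSignal [NeZero M] (hη : 1 ≤ η) (α β γ ρ lam : ℝ) (a e : Fin M → Bool) :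
    Measurable fun s : (Freq m lF → Fin M → ℂ) × (Freq m lF → Fin M → ℂ) ×
      (Freq m lF → Fin M → ℂ) × (Fin M → Fin lF → Pair m η → ℂ) =>
        bbuSignal α β γ ρ lam a e s.1 s.2.1 s.2.2.1 s.2.2.2 := by
  simp only [bbuSignal_eq hη]
  exact ((measurable_linearMap _).comp measurable_fst).add
    (((measurable_linearMap _).comp (measurable_fst.comp measurable_snd)).add
      (((measurable_linearMap _).comp (measurable_fst.comp (measurable_snd.comp
        measurable_snd))).add ((measurable_linearMap _).comp
          (measurable_snd.comp (measurable_snd.comp measurable_snd)))))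

lemma mutualInfo_cond_bbuSignal [NeZero M] {Ω : Type*} [MeasurableSpace Ω] {P : Measure Ω}
    [IsProbabilityMeasure P] (hη : 1 ≤ η) (α β γ ρ : ℝ) {lam q ε PB PU : ℝ} (hlam : 0 < lam)
    (hPB : 0 ≤ PB) (hPU : 0 ≤ PU) {A E : Ω → Fin M → Bool}
    {X U Z : Ω → Freq m lF → Fin M → ℂ} {W : Ω → Fin M → Fin lF → Pair m η → ℂ}
    (h : IsMinislotModel P q ε PB PU A E X U Z W) (s : (Fin M → Bool) × (Fin M → Bool))
    (hs : P ((fun ω => (A ω, E ω)) ⁻¹' {s}) ≠ 0) :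
    mutualInfo (P[|(fun ω => (A ω, E ω)) ⁻¹' {s}]) X
        (fun ω => bbuSignal α β γ ρ lam (A ω) (E ω) (X ω) (U ω) (Z ω) (W ω)) ≠ ∞ ∧
      (mutualInfo (P[|(fun ω => (A ω, E ω)) ⁻¹' {s}]) X
        (fun ω => bbuSignal α β γ ρ lam (A ω) (E ω) (X ω) (U ω) (Z ω) (W ω))).toReal =
          lF * Real.log (sicDet m η α β γ ρ lam PB PU s.1 s.2) := by
  have mX := h.measurable_X
  have mU := h.measurable_U
  have mZ := h.measurable_Z
  have mW := h.measurable_W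
  have mS : Measurable fun ω => (A ω, E ω) := h.measurable_A.prodMk h.measurable_E
  have mT : Measurable fun ω => (X ω, U ω, Z ω, W ω) := by fun_prop
  have hm : MeasurableSet ((fun ω => (A ω, E ω)) ⁻¹' {s}) := mS (measurableSet_singleton s)
  set P' := P[|(fun ω => (A ω, E ω)) ⁻¹' {s}] with hP'
  have hlaw : P'.map (fun ω => (X ω, U ω, Z ω, W ω)) = _ :=
    (map_cond_of_indepFun mS mT h.indep_AE hs).trans h.map_signals
  have mF := measurable_bbuSignal (m := m) (lF := lF) hη α β γ ρ lam s.1 s.2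
  -- The received signal depends on `(A, E)` also directly; under the conditional measure these can
  -- be frozen at `s` almost surely.
  have hae : ∀ᵐ ω ∂P', (A ω, E ω) = s := ae_cond_mem hm
  have e0 : P'.map X = iidComplexGaussian (Freq m lF) (Fin M) PB := by
    have : P'.map X = (P'.map (fun ω => (X ω, U ω, Z ω, W ω))).map Prod.fst := by
      rw [Measure.map_map measurable_fst mT]
      rfl
    rw [this, hlaw]
    exact measurePreserving_fst.map_eq
  have e1 : P'.map (fun ω => bbuSignal α β γ ρ lam (A ω) (E ω) (X ω) (U ω) (Z ω) (W ω)) =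
      (P'.map (fun ω => (X ω, U ω, Z ω, W ω))).map
        fun t => bbuSignal α β γ ρ lam s.1 s.2 t.1 t.2.1 t.2.2.1 t.2.2.2 := by
    rw [Measure.map_map mF mT]
    refine Measure.map_congr ?_
    filter_upwards [hae] with ω hω
    subst hω
    rfl
  have e2 : P'.map (fun ω => (X ω, bbuSignal α β γ ρ lam (A ω) (E ω) (X ω) (U ω) (Z ω) (W ω))) =
      (P'.map (fun ω => (X ω, U ω, Z ω, W ω))).map
        fun t => (t.1, bbuSignal α β γ ρ lam s.1 s.2 t.1 t.2.1 t.2.2.1 t.2.2.2) := by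
    rw [Measure.map_map (measurable_fst.prodMk mF) mT]
    refine Measure.map_congr ?_
    filter_upwards [hae] with ω hω
    subst hω
    rfl
  rw [mutualInfo, e0, e1, e2]
  exact klDiv_bbuSignal hη α β γ ρ hlam hPB hPU s.1 s.2 hlaw

lemma condMutualInfo_bbuSignal [NeZero M] {Ω : Type*} [MeasurableSpace Ω] {P : Measure Ω}
    [IsProbabilityMeasure P] (hη : 1 ≤ η) (α β γ ρ : ℝ) {lam q ε PB PU : ℝ} (hlam : 0 < lam)
    (hPB : 0 ≤ PB) (hPU : 0 ≤ PU) {A E : Ω → Fin M → Bool}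
    {X U Z : Ω → Freq m lF → Fin M → ℂ} {W : Ω → Fin M → Fin lF → Pair m η → ℂ}
    (h : IsMinislotModel P q ε PB PU A E X U Z W) :
    condMutualInfo P X
        (fun ω => bbuSignal α β γ ρ lam (A ω) (E ω) (X ω) (U ω) (Z ω) (W ω))
        (fun ω => (A ω, E ω)) ≠ ∞ ∧
      (condMutualInfo P X
        (fun ω => bbuSignal α β γ ρ lam (A ω) (E ω) (X ω) (U ω) (Z ω) (W ω))
        (fun ω => (A ω, E ω))).toReal =
          ∑ s : (Fin M → Bool) × (Fin M → Bool), (P ((fun ω => (A ω, E ω)) ⁻¹' {s})).toReal *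
            (lF * Real.log (sicDet m η α β γ ρ lam PB PU s.1 s.2)) := by
  have hterm := fun s hs => mutualInfo_cond_bbuSignal hη α β γ ρ hlam hPB hPU h s hs
  have hfin : ∀ s : (Fin M → Bool) × (Fin M → Bool), P ((fun ω => (A ω, E ω)) ⁻¹' {s}) *
      mutualInfo (P[|(fun ω => (A ω, E ω)) ⁻¹' {s}]) X
        (fun ω => bbuSignal α β γ ρ lam (A ω) (E ω) (X ω) (U ω) (Z ω) (W ω)) ≠ ∞ := fun s => by
    -- Null values of `(A, E)` get weight zero, so the conditional mutual information there is
    -- irrelevant (`0 * ∞ = 0` in `ℝ≥0∞`).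
    by_cases hs : P ((fun ω => (A ω, E ω)) ⁻¹' {s}) = 0
    · simp [hs]
    · exact ENNReal.mul_ne_top (measure_ne_top _ _) (hterm s hs).1
  refine ⟨ENNReal.sum_ne_top.2 fun s _ => hfin s, ?_⟩
  rw [condMutualInfo, ENNReal.toReal_sum fun s _ => hfin s]
  refine Finset.sum_congr rfl fun s _ => ?_
  by_cases hs : P ((fun ω => (A ω, E ω)) ⁻¹' {s}) = 0
  · simp [hs]
  · rw [ENNReal.toReal_mul, (hterm s hs).2]

lemma cableGain_pos {α PB Pc : ℝ} (hPB : 0 ≤ PB) (hPc : 0 < Pc) : 0 < cableGain α PB Pc :=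
  Real.sqrt_pos.2 (by positivity)

end CRAN

theorem lemma5
    {Ω : Type*} [MeasurableSpace Ω] (P : Measure Ω) [IsProbabilityMeasure P]
    (M m lF η : ℕ) [NeZero M] (hm : 1 ≤ m) (hlF : 1 ≤ lF) (hη : 1 ≤ η)
    (α β γ ρ q ε PB PU Pc : ℝ)
    (hα : α ∈ Set.Icc (0 : ℝ) 1) (hβ : 0 < β) (hγ : 0 ≤ γ) (hρ : ρ ∈ Set.Icc (0 : ℝ) 1)
    (hq : q ∈ Set.Icc (0 : ℝ) 1) (hε : ε ∈ Set.Icc (0 : ℝ) 1)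
    (hPB : 0 ≤ PB) (hPU : 0 ≤ PU) (hPc : 0 < Pc)
    (A E : Ω → Fin M → Bool) (X U Z : Ω → CRAN.Freq m lF → Fin M → ℂ)
    (W : Ω → Fin M → Fin lF → CRAN.Pair m η → ℂ)
    (hmodel : CRAN.IsMinislotModel P q ε PB PU A E X U Z W) :
    (∀ a e : Fin M → Bool,
      IsUnit (CRAN.sicNoiseCov m η β γ ρ (CRAN.cableGain α PB Pc) PU a e).det ∧
      0 < CRAN.sicDet m η α β γ ρ (CRAN.cableGain α PB Pc) PB PU a e) ∧
    Integrable (fun ω => Real.logb 2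
      (CRAN.sicDet m η α β γ ρ (CRAN.cableGain α PB Pc) PB PU (A ω) (E ω))) P ∧
    CRAN.eMBBRate P α β γ ρ (CRAN.cableGain α PB Pc) A E X U Z W ≠ ∞ ∧
    (CRAN.eMBBRate P α β γ ρ (CRAN.cableGain α PB Pc) A E X U Z W).toReal =
      CRAN.normBandwidth m lF / (M : ℝ) *
        ∫ ω, Real.logb 2
          (CRAN.sicDet m η α β γ ρ (CRAN.cableGain α PB Pc) PB PU (A ω) (E ω)) ∂P := by

  have hlam := CRAN.cableGain_pos (α := α) hPB hPc
  set lam := CRAN.cableGain α PB Pc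
  have mS : Measurable fun ω => (A ω, E ω) := hmodel.measurable_A.prodMk hmodel.measurable_E
  obtain ⟨hint, hval⟩ := integral_comp_fintype P mS
    (fun s => Real.logb 2 (CRAN.sicDet m η α β γ ρ lam PB PU s.1 s.2))
  obtain ⟨hI, hIval⟩ := CRAN.condMutualInfo_bbuSignal hη α β γ ρ hlam hPB hPU hmodel
  have hlog2 : 0 < Real.log 2 := Real.log_pos one_lt_two
  have hM : 0 < M := Nat.pos_of_neZero M
  refine ⟨fun a e => ⟨(CRAN.posDef_sicNoiseCov hη β γ ρ hlam hPU a e).det_pos.ne'.isUnit,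
    CRAN.sicDet_pos hη α β γ ρ hlam hPB hPU a e⟩, hint, ?_, ?_⟩
  · refine ENNReal.div_ne_top (ENNReal.div_ne_top hI ?_) ?_
    · simpa using hlog2
    · have : m * lF * M ≠ 0 := by positivity
      exact_mod_cast this
  · rw [CRAN.eMBBRate, ENNReal.toReal_div, ENNReal.toReal_div, hIval, hval,
      ENNReal.toReal_ofReal hlog2.le, ENNReal.toReal_natCast, CRAN.normBandwidth]
    -- The sums agree term by term: `lF / (m lF M) = μ / M`, and dividing by `log 2` converts nats
    -- to bits.
    simp only [Real.logb, Finset.sum_div, Finset.mul_sum]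
    refine Finset.sum_congr rfl fun s _ => ?_
    push_cast
    have : (0 : ℝ) < m := by exact_mod_cast hm
    have : (0 : ℝ) < lF := by exact_mod_cast hlF
    have : (0 : ℝ) < M := by exact_mod_cast hM
    field_simp
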